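/- Let $K$ be a field and let $E=(E^0,E^1,r,s)$ be a finite directed graph, i.e. $E^0$ (vertices) and $E^1$ (edges) are finite sets and $r,s:E^1\to E^0$ are arbitrary functions (range and source). Let $L_K(E)$ be the Leavitt path algebra of $E$ over $K$: the associative (not a priori unital) $K$-algebra generated by the set of vertices $v\in E^0$ together with symbols $e,e^*$ $(e\in E^1)$, subject to the relations 1. $vv'=\delta_{v,v'}v$ for all $v,v'\in E^0$; 2. $s(e)e=er(e)=e$ for all $e\in E^1$; 3. $r(e)e^*=e^*s(e)=e^*$ for all $e\in E^1$; 4. $e^*f=\delta_{e,f}\,r(e)$ for all $e,f\in E^1$; 5. $v=\sum_{\{e\in E^1\,:\,s(e)=v\}}ee^*$ for every $v\in E^0$ with $0<|s^{-1}(v)|<\infty$. Then $L_K(E)$ is two-sided Noetherian: for every ascending chain $I_0\subseteq I_1\subseteq I_2\subseteq\cdots$ of two-sided ideals of $L_K(E)$ there is an $n$ such that $I_m=I_n$ for all $m\ge n$. -/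

import Mathlib

universe u v w

/-- A directed graph `(E⁰, E¹, r, s)` with vertex set `V` and edge set `E`; loops and parallel
edges are allowed, and no finiteness is imposed. -/
structure DirectedGraph (V : Type v) (E : Type w) where
  /-- the source of an edge -/
  s : E → V
  /-- the range of an edge -/
  r : E → V

/-- The generators of the Leavitt path algebra: vertices `v`, real edges `e`, ghost edges `e*`. -/
inductive LeavittGen (V : Type v) (E : Type w) : Type (max v w)
  | vert : V → LeavittGen V E
  | edge : E → LeavittGen V E
  | ghost : E → LeavittGen V E

/-- The free associative (not necessarily unital) `K`-algebra on the generators: the semigroup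
algebra over `K` of the free semigroup of nonempty words in the generators. -/
abbrev LeavittFree (K : Type u) [Field K] (V : Type v) (E : Type w) : Type (max u v w) :=
  MonoidAlgebra K (FreeSemigroup (LeavittGen V E))

namespace LeavittFree

variable (K : Type u) [Field K] {V : Type v} {E : Type w}

/-- A generator, as an element of the free algebra. -/
noncomputable def gen (x : LeavittGen V E) : LeavittFree K V E :=
  MonoidAlgebra.single (FreeSemigroup.of x) 1

/-- The vertex `v`, as an element of the free algebra. -/
noncomputable abbrev vert (v : V) : LeavittFree K V E := gen K (.vert v)

/-- The real edge `e`, as an element of the free algebra. -/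
noncomputable abbrev edge (e : E) : LeavittFree K V E := gen K (.edge e)

/-- The ghost edge `e*`, as an element of the free algebra. -/
noncomputable abbrev ghost (e : E) : LeavittFree K V E := gen K (.ghost e)

end LeavittFree

open LeavittFree in
/-- The defining relations of the Leavitt path algebra, together with their scalar multiples. The
free algebra has no unit, so the scalar multiples are needed in order that the ring congruence
generated by the relations is a congruence of `K`-algebras. -/
inductive LeavittRel (K : Type u) [Field K] {V : Type v} {E : Type w} (G : DirectedGraph V E) :
    LeavittFree K V E → LeavittFree K V E → Prop
  | vert_mul_self (a : V) : LeavittRel K G (vert K a * vert K a) (vert K a)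
  | vert_mul_of_ne (a b : V) (h : a ≠ b) : LeavittRel K G (vert K a * vert K b) 0
  | source_mul_edge (e : E) : LeavittRel K G (vert K (G.s e) * edge K e) (edge K e)
  | edge_mul_range (e : E) : LeavittRel K G (edge K e * vert K (G.r e)) (edge K e)
  | range_mul_ghost (e : E) : LeavittRel K G (vert K (G.r e) * ghost K e) (ghost K e)
  | ghost_mul_source (e : E) : LeavittRel K G (ghost K e * vert K (G.s e)) (ghost K e)
  | ghost_mul_self (e : E) : LeavittRel K G (ghost K e * edge K e) (vert K (G.r e))
  | ghost_mul_of_ne (e f : E) (h : e ≠ f) : LeavittRel K G (ghost K e * edge K f) 0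
  | vert_eq_sum (a : V) (hne : {e : E | G.s e = a}.Nonempty) (hfin : {e : E | G.s e = a}.Finite) :
      LeavittRel K G (vert K a) (∑ e ∈ hfin.toFinset, edge K e * ghost K e)
  | smul (k : K) {x y : LeavittFree K V E} (h : LeavittRel K G x y) :
      LeavittRel K G (k • x) (k • y)

/-- The Leavitt path algebra `L_K(E)`: the associative `K`-algebra (with no unit in general)
presented by the vertices, real edges and ghost edges and the relations `LeavittRel`. -/
def LeavittPathAlgebra (K : Type u) [Field K] {V : Type v} {E : Type w}
    (G : DirectedGraph V E) : Type (max u v w) :=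
  (ringConGen (LeavittRel K G)).Quotient

namespace LeavittPathAlgebra

variable {K : Type u} [Field K] {V : Type v} {E : Type w} {G : DirectedGraph V E}

noncomputable instance : NonUnitalRing (LeavittPathAlgebra K G) :=
  inferInstanceAs (NonUnitalRing (ringConGen (LeavittRel K G)).Quotient)

variable (K G) in
/-- The class in `L_K(E)` of an element of the free algebra. -/
noncomputable def mk (x : LeavittFree K V E) : LeavittPathAlgebra K G :=
  ((x : (ringConGen (LeavittRel K G)).Quotient))

theorem mk_eq_mk {x y : LeavittFree K V E} :
    mk K G x = mk K G y ↔ ringConGen (LeavittRel K G) x y :=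
  RingCon.eq _

theorem mk_surjective : Function.Surjective (mk K G) :=
  Quotient.mk''_surjective

theorem mk_add (x y : LeavittFree K V E) : mk K G (x + y) = mk K G x + mk K G y := rfl

theorem mk_mul (x y : LeavittFree K V E) : mk K G (x * y) = mk K G x * mk K G y := rfl

theorem mk_zero : mk K G 0 = 0 := rfl

theorem ringConGen_smul (k : K) {x y : LeavittFree K V E}
    (h : ringConGen (LeavittRel K G) x y) : ringConGen (LeavittRel K G) (k • x) (k • y) := by
  change RingConGen.Rel _ _ _ at h
  induction h with
  | of x y h => exact RingConGen.Rel.of _ _ (.smul k h)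
  | refl x => exact RingCon.refl _ _
  | symm _ ih => exact RingCon.symm _ ih
  | trans _ _ ih₁ ih₂ => exact RingCon.trans _ ih₁ ih₂
  | add _ _ ih₁ ih₂ =>
    rw [smul_add, smul_add]
    exact RingCon.add _ ih₁ ih₂
  | mul _ h₂ ih₁ _ =>
    rw [← smul_mul_assoc, ← smul_mul_assoc]
    exact RingCon.mul _ ih₁ h₂

noncomputable instance : SMul K (LeavittPathAlgebra K G) where
  smul k := Quotient.map' (k • ·) fun _ _ h => ringConGen_smul k h

theorem mk_smul (k : K) (x : LeavittFree K V E) : mk K G (k • x) = k • mk K G x := rfl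

noncomputable instance : Module K (LeavittPathAlgebra K G) :=
  Function.Surjective.module K
    (⟨⟨mk K G, mk_zero⟩, mk_add⟩ : LeavittFree K V E →+ LeavittPathAlgebra K G)
    mk_surjective mk_smul

instance : IsScalarTower K (LeavittPathAlgebra K G) (LeavittPathAlgebra K G) where
  smul_assoc k x y := by
    obtain ⟨x, rfl⟩ := mk_surjective x
    obtain ⟨y, rfl⟩ := mk_surjective y
    simp only [smul_eq_mul, ← mk_smul, ← mk_mul, smul_mul_assoc]

instance : SMulCommClass K (LeavittPathAlgebra K G) (LeavittPathAlgebra K G) where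
  smul_comm k x y := by
    obtain ⟨x, rfl⟩ := mk_surjective x
    obtain ⟨y, rfl⟩ := mk_surjective y
    simp only [smul_eq_mul, ← mk_smul, ← mk_mul, mul_smul_comm]

end LeavittPathAlgebra

/-- A ring (with or without unit) is two-sided Noetherian if it satisfies the ascending chain
condition on two-sided ideals: every ascending chain `I₀ ⊆ I₁ ⊆ I₂ ⊆ ⋯` becomes stationary. -/
def IsTwoSidedNoetherian (R : Type u) [NonUnitalRing R] : Prop :=
  ∀ I : ℕ → TwoSidedIdeal R, Monotone I → ∃ n, ∀ m, n ≤ m → I m = I n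

/-!
To each two-sided ideal `I` of `L_K(E)` and each vertex `b` attach the ideal `loopIdeal I b` of
`K[X]`: the polynomials `p` with `p(c) ∈ I`, where `c` is a shortest closed path at `b` of positive
length (if there is none, the value of `p` is a scalar multiple of `b`). Since `K[X]` is Noetherian
and there are finitely many vertices, an ascending chain of two-sided ideals eventually has constant
loop ideals. So it suffices that ideals `I ≤ J` with the same loop ideals are equal
(`eq_of_loopIdeal_eq`).

Suppose `x ∈ J` and `x ∉ I`. By the relation `a = ∑ e e*` for the vertices `a` that emit edges, `x`
is the sum of the elements `(x e) e*`, for the edges `e`, and `x a`, for the sinks `a`. So some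
`x e` or `x a` is not in `I`; repeating this removes all ghost edges from `x`
(`exists_realSpan_mem_notMem`). The same on the left, with `e* x`, shortens the real paths in `x`
until a trivial one appears (`exists_constant_ne_zero`). The result is an element `k b + y` of `J`
outside `I`, with `k ≠ 0` and `y` a combination of nonempty closed paths at `b`.

If every closed path at `b` is a power of `c`, then `k b + y = p(c)` for a polynomial `p`, which is
in the loop ideal of `J` and so in that of `I`, a contradiction. Otherwise there is a closed path
`d` at `b` such that neither of `c`, `d` is an initial segment of the other, whence `d* c = 0`. For
large `n` the element `(c*)ⁿ y cⁿ` lies in `c L_K(E)`, so that `d* (c*)ⁿ (k b + y) cⁿ d = k b`.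
Hence `b ∈ J`; the constant polynomial `1` is in the loop ideal of `J`, so in that of `I`, and
`b ∈ I`, which again is a contradiction (`vert_mem_or_mem_range_evalLoop`).
-/

open Polynomial

namespace DirectedGraph

variable {V : Type v} {E : Type w} (G : DirectedGraph V E)

/-- `G.IsPathFrom a l b`: the list of edges `l` is a path from the vertex `a` to the vertex `b`.
The empty list is the trivial path at each vertex. -/
def IsPathFrom : V → List E → V → Prop
  | a, [], b => a = b
  | a, e :: l, b => G.s e = a ∧ IsPathFrom (G.r e) l b

/-- The nonempty closed paths based at the vertex `a`. -/
def closedPaths (a : V) : Set (List E) := {l | l ≠ [] ∧ G.IsPathFrom a l a}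

variable {G}

theorem IsPathFrom.of_append {a b c : V} {l m : List E} (h : G.IsPathFrom a l b)
    (h' : G.IsPathFrom a (l ++ m) c) : G.IsPathFrom b m c := by
  induction l generalizing a with
  | nil => cases h; exact h'
  | cons e l ih => exact ih h.2 h'.2

variable (G) in
open Classical in
/-- A closed path of least positive length based at `a`, or the empty list if `a` lies on no closed
path. -/
noncomputable def shortestLoop (a : V) : List E :=
  if h : (G.closedPaths a).Nonempty then Function.argminOn List.length (G.closedPaths a) h else []

theorem shortestLoop_mem {a : V} (h : (G.closedPaths a).Nonempty) :
    G.shortestLoop a ∈ G.closedPaths a := by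
  rw [shortestLoop, dif_pos h]
  exact Function.argminOn_mem _ _ _

theorem length_shortestLoop_le {a : V} {l : List E} (h : l ∈ G.closedPaths a) :
    (G.shortestLoop a).length ≤ l.length := by
  rw [shortestLoop, dif_pos ⟨l, h⟩]
  exact Function.argminOn_le _ _ h

/-- By minimality, a closed path that is an initial segment of the shortest one equals it. -/
theorem shortestLoop_prefix_of_prefix {a : V} {l : List E} (h : l ∈ G.closedPaths a)
    (hl : l <+: G.shortestLoop a) : G.shortestLoop a <+: l := by
  rw [hl.eq_of_length_le (length_shortestLoop_le h)]

end DirectedGraph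

namespace LeavittPathAlgebra

variable {K : Type u} [Field K] {V : Type v} {E : Type w} {G : DirectedGraph V E}

/-! ### The generators and their relations -/

variable (K G) in
/-- The class of a generator in `L_K(E)`. -/
noncomputable def gen (x : LeavittGen V E) : LeavittPathAlgebra K G := mk K G (LeavittFree.gen K x)

variable (K G) in
/-- The vertex `a` in `L_K(E)`. -/
noncomputable def vert (a : V) : LeavittPathAlgebra K G := gen K G (.vert a)

variable (K G) in
/-- The real edge `e` in `L_K(E)`. -/
noncomputable def edge (e : E) : LeavittPathAlgebra K G := gen K G (.edge e)

variable (K G) in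
/-- The ghost edge `e*` in `L_K(E)`. -/
noncomputable def ghost (e : E) : LeavittPathAlgebra K G := gen K G (.ghost e)

theorem mk_eq_of_rel {x y : LeavittFree K V E} (h : LeavittRel K G x y) : mk K G x = mk K G y :=
  mk_eq_mk.2 (RingConGen.Rel.of _ _ h)

theorem vert_mul_self (a : V) : vert K G a * vert K G a = vert K G a :=
  mk_eq_of_rel (.vert_mul_self a)

theorem vert_mul_of_ne {a b : V} (h : a ≠ b) : vert K G a * vert K G b = 0 :=
  mk_eq_of_rel (.vert_mul_of_ne a b h)

theorem source_mul_edge (e : E) : vert K G (G.s e) * edge K G e = edge K G e :=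
  mk_eq_of_rel (.source_mul_edge e)

theorem edge_mul_range (e : E) : edge K G e * vert K G (G.r e) = edge K G e :=
  mk_eq_of_rel (.edge_mul_range e)

theorem range_mul_ghost (e : E) : vert K G (G.r e) * ghost K G e = ghost K G e :=
  mk_eq_of_rel (.range_mul_ghost e)

theorem ghost_mul_source (e : E) : ghost K G e * vert K G (G.s e) = ghost K G e :=
  mk_eq_of_rel (.ghost_mul_source e)

theorem ghost_mul_self (e : E) : ghost K G e * edge K G e = vert K G (G.r e) :=
  mk_eq_of_rel (.ghost_mul_self e)

theorem ghost_mul_of_ne {e f : E} (h : e ≠ f) : ghost K G e * edge K G f = 0 :=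
  mk_eq_of_rel (.ghost_mul_of_ne e f h)

theorem mk_sum {ι : Type*} (s : Finset ι) (f : ι → LeavittFree K V E) :
    mk K G (∑ i ∈ s, f i) = ∑ i ∈ s, mk K G (f i) :=
  map_sum (⟨⟨mk K G, mk_zero⟩, mk_add⟩ : LeavittFree K V E →+ LeavittPathAlgebra K G) f s

theorem vert_eq_sum [Finite E] {a : V} (h : ∃ e, G.s e = a) :
    vert K G a = ∑ e ∈ (Set.toFinite {e | G.s e = a}).toFinset, edge K G e * ghost K G e :=
  (mk_eq_of_rel (.vert_eq_sum a h (Set.toFinite _))).trans (mk_sum _ _)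

theorem vert_mul_edge_of_ne {a : V} {e : E} (h : a ≠ G.s e) : vert K G a * edge K G e = 0 := by
  rw [← source_mul_edge, ← mul_assoc, vert_mul_of_ne h, zero_mul]

theorem ghost_mul_vert_of_ne {a : V} {e : E} (h : G.s e ≠ a) : ghost K G e * vert K G a = 0 := by
  rw [← ghost_mul_source, mul_assoc, vert_mul_of_ne h, mul_zero]

/-- Induction along words in the generators, read from the left. -/
theorem induction_gen_mul {p : LeavittPathAlgebra K G → Prop} (x : LeavittPathAlgebra K G)
    (zero : p 0) (add : ∀ x y, p x → p y → p (x + y)) (smul : ∀ (k : K) x, p x → p (k • x))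
    (gen : ∀ g, p (gen K G g)) (gen_mul : ∀ g x, p x → p (LeavittPathAlgebra.gen K G g * x)) :
    p x := by
  obtain ⟨x, rfl⟩ := mk_surjective x
  have word (t : FreeSemigroup (LeavittGen V E)) : p (mk K G (MonoidAlgebra.single t 1)) := by
    induction t using FreeSemigroup.recOnMul with
    | ih1 g => exact gen g
    | ih2 g t _ ih =>
      have := gen_mul g _ ih
      rwa [LeavittPathAlgebra.gen, ← mk_mul, LeavittFree.gen, MonoidAlgebra.single_mul_single,
        mul_one] at this
  induction x using MonoidAlgebra.induction_linear with
  | zero => exact zero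
  | add x y hx hy => exact mk_add (G := G) x y ▸ add _ _ hx hy
  | single t k =>
    have := smul k _ (word t)
    rwa [← mk_smul, MonoidAlgebra.smul_single, smul_eq_mul, mul_one] at this

theorem sum_vert_mul_vert [Fintype V] (a : V) : (∑ b, vert K G b) * vert K G a = vert K G a := by
  rw [Finset.sum_mul, Finset.sum_eq_single_of_mem a (Finset.mem_univ a)
    fun b _ h => vert_mul_of_ne h, vert_mul_self]

theorem vert_mul_sum_vert [Fintype V] (a : V) : vert K G a * (∑ b, vert K G b) = vert K G a := by
  rw [Finset.mul_sum, Finset.sum_eq_single_of_mem a (Finset.mem_univ a)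
    fun b _ h => vert_mul_of_ne h.symm, vert_mul_self]

theorem sum_vert_mul [Fintype V] (x : LeavittPathAlgebra K G) : (∑ a, vert K G a) * x = x := by
  have hgen (g : LeavittGen V E) : (∑ a, vert K G a) * gen K G g = gen K G g := by
    cases g with
    | vert a => exact sum_vert_mul_vert a
    | edge e =>
      change _ * edge K G e = edge K G e
      rw [← source_mul_edge, ← mul_assoc, sum_vert_mul_vert]
    | ghost e =>
      change _ * ghost K G e = ghost K G e
      rw [← range_mul_ghost, ← mul_assoc, sum_vert_mul_vert]
  induction x using induction_gen_mul with
  | zero => exact mul_zero _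
  | add x y hx hy => rw [mul_add, hx, hy]
  | smul k x hx => rw [mul_smul_comm, hx]
  | gen g => exact hgen g
  | gen_mul g x _ => rw [← mul_assoc, hgen]

theorem mul_sum_vert [Fintype V] (x : LeavittPathAlgebra K G) : x * (∑ a, vert K G a) = x := by
  induction x using induction_gen_mul with
  | zero => exact zero_mul _
  | add x y hx hy => rw [add_mul, hx, hy]
  | smul k x hx => rw [smul_mul_assoc, hx]
  | gen g =>
    cases g with
    | vert a => exact vert_mul_sum_vert a
    | edge e =>
      change edge K G e * _ = edge K G e
      rw [← edge_mul_range, mul_assoc, vert_mul_sum_vert]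
    | ghost e =>
      change ghost K G e * _ = ghost K G e
      rw [← ghost_mul_source, mul_assoc, vert_mul_sum_vert]
  | gen_mul g x hx => rw [mul_assoc, hx]

/-! ### Two-sided ideals -/

section Ideal

variable (I : TwoSidedIdeal (LeavittPathAlgebra K G))

/-- Two-sided ideals are closed under scalars because the sum of the vertices is a unit. -/
theorem smul_mem [Finite V] (k : K) {x : LeavittPathAlgebra K G} (hx : x ∈ I) : k • x ∈ I := by
  cases nonempty_fintype V
  rw [← sum_vert_mul x, ← smul_mul_assoc]
  exact I.mul_mem_left _ _ hx

theorem mem_of_forall_mul_vert_mem [Finite V] {x : LeavittPathAlgebra K G}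
    (h : ∀ a, x * vert K G a ∈ I) : x ∈ I := by
  cases nonempty_fintype V
  rw [← mul_sum_vert x, Finset.mul_sum]
  exact sum_mem fun a _ => h a

theorem mem_of_forall_vert_mul_mem [Finite V] {x : LeavittPathAlgebra K G}
    (h : ∀ a, vert K G a * x ∈ I) : x ∈ I := by
  cases nonempty_fintype V
  rw [← sum_vert_mul x, Finset.sum_mul]
  exact sum_mem fun a _ => h a

theorem mul_vert_mem_of_forall_mul_edge_mem [Finite E] {x : LeavittPathAlgebra K G} {a : V}
    (ha : ∃ e, G.s e = a) (h : ∀ e, G.s e = a → x * edge K G e ∈ I) : x * vert K G a ∈ I := by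
  rw [vert_eq_sum ha, Finset.mul_sum]
  refine sum_mem fun e he => ?_
  rw [← mul_assoc]
  exact I.mul_mem_right _ _ (h e (by simpa using he))

theorem vert_mul_mem_of_forall_ghost_mul_mem [Finite E] {x : LeavittPathAlgebra K G} {a : V}
    (ha : ∃ e, G.s e = a) (h : ∀ e, G.s e = a → ghost K G e * x ∈ I) : vert K G a * x ∈ I := by
  rw [vert_eq_sum ha, Finset.sum_mul]
  refine sum_mem fun e he => ?_
  rw [mul_assoc]
  exact I.mul_mem_left _ _ (h e (by simpa using he))

end Ideal

/-! ### Real and ghost paths -/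

variable (K G) in
/-- The product `e₁ ⋯ eₙ b` in `L_K(E)`. It vanishes unless `e₁ ⋯ eₙ` is a path that ends at `b`. -/
noncomputable def path : List E → V → LeavittPathAlgebra K G
  | [], b => vert K G b
  | e :: l, b => edge K G e * path l b

variable (K G) in
/-- The product `b eₙ* ⋯ e₁*` in `L_K(E)`. -/
noncomputable def ghostPath : List E → V → LeavittPathAlgebra K G
  | [], b => vert K G b
  | e :: l, b => ghostPath l b * ghost K G e

theorem path_mul_vert (l : List E) (b : V) : path K G l b * vert K G b = path K G l b := by
  induction l with
  | nil => exact vert_mul_self b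
  | cons e l ih => rw [path, mul_assoc, ih]

theorem path_mul_vert_of_ne (l : List E) {b a : V} (h : b ≠ a) :
    path K G l b * vert K G a = 0 := by
  rw [← path_mul_vert, mul_assoc, vert_mul_of_ne h, mul_zero]

theorem vert_mul_path {a b : V} {l : List E} (h : G.IsPathFrom a l b) :
    vert K G a * path K G l b = path K G l b := by
  cases l with
  | nil => cases h; exact vert_mul_self _
  | cons e l => rw [path, ← mul_assoc, ← h.1, source_mul_edge]

theorem vert_mul_path_of_not {a b : V} {l : List E} (h : ¬ G.IsPathFrom a l b) :
    vert K G a * path K G l b = 0 := by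
  induction l generalizing a with
  | nil => exact vert_mul_of_ne h
  | cons e l ih =>
    by_cases ha : a = G.s e
    · rw [path, ← edge_mul_range, mul_assoc (edge K G e), ih fun h' => h ⟨ha.symm, h'⟩, mul_zero,
        mul_zero]
    · rw [path, ← mul_assoc, vert_mul_edge_of_ne ha, zero_mul]

theorem vert_mul_path_cases (a : V) (l : List E) (b : V) :
    vert K G a * path K G l b = path K G l b ∨ vert K G a * path K G l b = 0 :=
  (em (G.IsPathFrom a l b)).imp vert_mul_path vert_mul_path_of_not

theorem path_append {b c : V} (l : List E) {m : List E} (h : G.IsPathFrom b m c) :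
    path K G (l ++ m) c = path K G l b * path K G m c := by
  induction l with
  | nil => exact (vert_mul_path h).symm
  | cons e l ih => rw [List.cons_append, path, ih, path, mul_assoc]

theorem ghostPath_mul_path {a b : V} {l : List E} (h : G.IsPathFrom a l b) :
    ghostPath K G l b * path K G l b = vert K G b := by
  induction l generalizing a with
  | nil => exact vert_mul_self b
  | cons e l ih =>
    rw [ghostPath, path, mul_assoc, ← mul_assoc (ghost K G e), ghost_mul_self, vert_mul_path h.2,
      ih h.2]

/-- If neither of two paths is an initial segment of the other, they differ at some first edge, and
the relation `e* f = 0` applies there. -/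
theorem ghostPath_mul_path_of_not_prefix {l m : List E} (b c : V) (h : ¬ l <+: m)
    (h' : ¬ m <+: l) : ghostPath K G l b * path K G m c = 0 := by
  induction l generalizing m with
  | nil => exact absurd m.nil_prefix h
  | cons e l ih =>
    cases m with
    | nil => exact absurd (List.nil_prefix) h'
    | cons f m =>
      rw [ghostPath, path, mul_assoc, ← mul_assoc (ghost K G e)]
      by_cases hef : e = f
      · subst hef
        rw [List.prefix_cons_inj] at h h'
        rw [ghost_mul_self]
        rcases vert_mul_path_cases (K := K) (G.r e) m c with h0 | h0
        · rw [h0, ih h h']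
        · rw [h0, mul_zero]
      · rw [ghost_mul_of_ne hef, zero_mul, mul_zero]

/-! ### Removing ghost edges -/

variable (K G) in
/-- The span of the real paths. -/
noncomputable def realSpan : Submodule K (LeavittPathAlgebra K G) :=
  Submodule.span K {x | ∃ l b, x = path K G l b}

theorem path_mem_realSpan (l : List E) (b : V) : path K G l b ∈ realSpan K G :=
  Submodule.subset_span ⟨l, b, rfl⟩

theorem realSpan_mul_vert_mem {x : LeavittPathAlgebra K G} (hx : x ∈ realSpan K G) (a : V) :
    x * vert K G a ∈ realSpan K G := by
  induction hx using Submodule.span_induction with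
  | mem x h =>
    obtain ⟨l, b, rfl⟩ := h
    by_cases hb : b = a
    · subst hb
      rw [path_mul_vert]
      exact path_mem_realSpan l b
    · rw [path_mul_vert_of_ne l hb]
      exact zero_mem _
  | zero => rw [zero_mul]; exact zero_mem _
  | add x y _ _ hx hy => rw [add_mul]; exact add_mem hx hy
  | smul k x _ hx => rw [smul_mul_assoc]; exact Submodule.smul_mem _ _ hx

theorem path_mul_edge_mem (l : List E) (b : V) (e : E) :
    path K G l b * edge K G e ∈ realSpan K G := by
  by_cases hb : b = G.s e
  · have : edge K G e = path K G [e] (G.r e) := (edge_mul_range e).symm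
    rw [this, ← path_append l (m := [e]) ⟨hb.symm, rfl⟩]
    exact path_mem_realSpan _ _
  · rw [← path_mul_vert, mul_assoc, vert_mul_edge_of_ne hb, mul_zero]
    exact zero_mem _

theorem realSpan_mul_edge_mem {x : LeavittPathAlgebra K G} (hx : x ∈ realSpan K G) (e : E) :
    x * edge K G e ∈ realSpan K G := by
  induction hx using Submodule.span_induction with
  | mem x h =>
    obtain ⟨l, b, rfl⟩ := h
    exact path_mul_edge_mem l b e
  | zero => rw [zero_mul]; exact zero_mem _
  | add x y _ _ hx hy => rw [add_mul]; exact add_mem hx hy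
  | smul k x _ hx => rw [smul_mul_assoc]; exact Submodule.smul_mem _ _ hx

variable (K G) in
/-- The elements whose ghost edges are all removed by right multiplication with any path that has
length `n`, or that is shorter and ends at a sink. -/
noncomputable def ghostFiltration : ℕ → Submodule K (LeavittPathAlgebra K G)
  | 0 => realSpan K G
  | n + 1 =>
    { carrier := {x | (∀ e, x * edge K G e ∈ ghostFiltration n) ∧
        ∀ a, (∀ e, G.s e ≠ a) → x * vert K G a ∈ realSpan K G}
      zero_mem' := by simp
      add_mem' := fun hx hy => ⟨fun e => add_mul _ _ (edge K G e) ▸ add_mem (hx.1 e) (hy.1 e),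
        fun a ha => add_mul _ _ (vert K G a) ▸ add_mem (hx.2 a ha) (hy.2 a ha)⟩
      smul_mem' := fun k x hx => ⟨fun e => by
          rw [smul_mul_assoc]; exact Submodule.smul_mem _ _ (hx.1 e),
        fun a ha => by rw [smul_mul_assoc]; exact Submodule.smul_mem _ _ (hx.2 a ha)⟩ }

theorem ghostFiltration_le_succ (n : ℕ) :
    ghostFiltration K G n ≤ ghostFiltration K G (n + 1) := by
  induction n with
  | zero =>
    exact fun x hx => ⟨realSpan_mul_edge_mem hx, fun a _ => realSpan_mul_vert_mem hx a⟩
  | succ n ih => exact fun x hx => ⟨fun e => ih (hx.1 e), hx.2⟩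

theorem ghostFiltration_mono : Monotone (ghostFiltration K G) :=
  monotone_nat_of_le_succ ghostFiltration_le_succ

theorem mul_mem_ghostFiltration_of_real {g : LeavittPathAlgebra K G}
    (hg : ∀ x ∈ realSpan K G, g * x ∈ realSpan K G) {n : ℕ} {x : LeavittPathAlgebra K G}
    (hx : x ∈ ghostFiltration K G n) : g * x ∈ ghostFiltration K G n := by
  induction n generalizing x with
  | zero => exact hg x hx
  | succ n ih =>
    exact ⟨fun e => mul_assoc g x _ ▸ ih (hx.1 e), fun a ha => mul_assoc g x _ ▸ hg _ (hx.2 a ha)⟩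

theorem vert_mul_mem_realSpan (a : V) {x : LeavittPathAlgebra K G} (hx : x ∈ realSpan K G) :
    vert K G a * x ∈ realSpan K G := by
  induction hx using Submodule.span_induction with
  | mem x h =>
    obtain ⟨l, b, rfl⟩ := h
    rcases vert_mul_path_cases (K := K) (G := G) a l b with h0 | h0 <;> rw [h0]
    · exact path_mem_realSpan l b
    · exact zero_mem _
  | zero => rw [mul_zero]; exact zero_mem _
  | add x y _ _ hx hy => rw [mul_add]; exact add_mem hx hy
  | smul k x _ hx => rw [mul_smul_comm]; exact Submodule.smul_mem _ _ hx

theorem edge_mul_mem_realSpan (e : E) {x : LeavittPathAlgebra K G} (hx : x ∈ realSpan K G) :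
    edge K G e * x ∈ realSpan K G := by
  induction hx using Submodule.span_induction with
  | mem x h =>
    obtain ⟨l, b, rfl⟩ := h
    exact path_mem_realSpan (e :: l) b
  | zero => rw [mul_zero]; exact zero_mem _
  | add x y _ _ hx hy => rw [mul_add]; exact add_mem hx hy
  | smul k x _ hx => rw [mul_smul_comm]; exact Submodule.smul_mem _ _ hx

theorem ghost_mul_edge_mem_realSpan (e f : E) : ghost K G e * edge K G f ∈ realSpan K G := by
  by_cases h : e = f
  · rw [h, ghost_mul_self]
    exact path_mem_realSpan [] _
  · rw [ghost_mul_of_ne h]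
    exact zero_mem _

theorem ghost_mem_ghostFiltration (e : E) : ghost K G e ∈ ghostFiltration K G 1 := by
  refine ⟨fun f => ghost_mul_edge_mem_realSpan e f, fun a ha => ?_⟩
  rw [ghost_mul_vert_of_ne (ha e)]
  exact zero_mem _

theorem ghost_mul_path_mem (e : E) (l : List E) (b : V) :
    ghost K G e * path K G l b ∈ ghostFiltration K G 1 := by
  cases l with
  | nil =>
    by_cases hb : G.s e = b
    · subst hb
      rw [path, ghost_mul_source]
      exact ghost_mem_ghostFiltration e
    · rw [path, ghost_mul_vert_of_ne hb]
      exact zero_mem _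
  | cons f l =>
    rw [path, ← mul_assoc]
    refine ghostFiltration_le_succ 0 ?_
    by_cases h : e = f
    · rw [h, ghost_mul_self]
      exact vert_mul_mem_realSpan _ (path_mem_realSpan l b)
    · rw [ghost_mul_of_ne h, zero_mul]
      exact zero_mem _

theorem ghost_mul_mem_ghostFiltration (e : E) {n : ℕ} {x : LeavittPathAlgebra K G}
    (hx : x ∈ ghostFiltration K G n) : ghost K G e * x ∈ ghostFiltration K G (n + 1) := by
  have real {x : LeavittPathAlgebra K G} (hx : x ∈ realSpan K G) :
      ghost K G e * x ∈ ghostFiltration K G 1 := by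
    induction hx using Submodule.span_induction with
    | mem x h =>
      obtain ⟨l, b, rfl⟩ := h
      exact ghost_mul_path_mem e l b
    | zero => rw [mul_zero]; exact zero_mem _
    | add x y _ _ hx hy => rw [mul_add]; exact add_mem hx hy
    | smul k x _ hx => rw [mul_smul_comm]; exact Submodule.smul_mem _ _ hx
  induction n generalizing x with
  | zero => exact real hx
  | succ n ih =>
    refine ⟨fun f => mul_assoc (ghost K G e) x _ ▸ ih (hx.1 f), fun a ha => ?_⟩
    -- As `x * a` is fixed by right multiplication with `a`, the case of a real element applies.
    have := (real (hx.2 a ha)).2 a ha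
    rwa [mul_assoc, mul_assoc, vert_mul_self, ← mul_assoc] at this

/-- The ghost filtration is exhaustive. Its union contains the generators and is stable under left
multiplication by them. -/
theorem exists_mem_ghostFiltration (x : LeavittPathAlgebra K G) :
    ∃ n, x ∈ ghostFiltration K G n := by
  induction x using induction_gen_mul with
  | zero => exact ⟨0, zero_mem _⟩
  | add x y hx hy =>
    obtain ⟨m, hm⟩ := hx
    obtain ⟨n, hn⟩ := hy
    exact ⟨max m n, add_mem (ghostFiltration_mono (le_max_left m n) hm)
      (ghostFiltration_mono (le_max_right m n) hn)⟩
  | smul k x hx => exact hx.imp fun n h => Submodule.smul_mem _ _ h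
  | gen g =>
    cases g with
    | vert a => exact ⟨0, path_mem_realSpan [] a⟩
    | edge e =>
      refine ⟨0, ?_⟩
      change edge K G e ∈ realSpan K G
      rw [← edge_mul_range]
      exact path_mem_realSpan [e] _
    | ghost e => exact ⟨1, ghost_mem_ghostFiltration e⟩
  | gen_mul g x hx =>
    obtain ⟨n, hn⟩ := hx
    cases g with
    | vert a => exact ⟨n, mul_mem_ghostFiltration_of_real (fun _ => vert_mul_mem_realSpan a) hn⟩
    | edge e => exact ⟨n, mul_mem_ghostFiltration_of_real (fun _ => edge_mul_mem_realSpan e) hn⟩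
    | ghost e => exact ⟨n + 1, ghost_mul_mem_ghostFiltration e hn⟩

section Reduction

variable {I J : TwoSidedIdeal (LeavittPathAlgebra K G)}

/-- If `x` lies outside `I`, so does a right multiple of `x` that involves no ghost edges. -/
theorem exists_realSpan_mem_notMem [Finite V] [Finite E] {x : LeavittPathAlgebra K G}
    (hJ : x ∈ J) (hI : x ∉ I) :
    ∃ y ∈ realSpan K G, y ∈ J ∧ y ∉ I := by
  obtain ⟨n, hn⟩ := exists_mem_ghostFiltration x
  induction n generalizing x with
  | zero => exact ⟨x, hn, hJ, hI⟩
  | succ n ih =>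
    by_contra hno
    refine hI (mem_of_forall_mul_vert_mem I fun a => ?_)
    by_cases ha : ∃ e, G.s e = a
    · refine mul_vert_mem_of_forall_mul_edge_mem I ha fun e _ => ?_
      by_contra he
      exact hno (ih (J.mul_mem_right _ _ hJ) he (hn.1 e))
    · by_contra hxa
      exact hno ⟨_, hn.2 a (by simpa using ha), J.mul_mem_right _ _ hJ, hxa⟩

/-! ### Producing a nonzero constant term -/

variable (K G) in
/-- The span of the nonempty real paths of length at most `n` that end at `b`. -/
noncomputable def pathSpan (n : ℕ) (b : V) : Submodule K (LeavittPathAlgebra K G) :=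
  Submodule.span K {x | ∃ l : List E, l ≠ [] ∧ l.length ≤ n ∧ x = path K G l b}

theorem pathSpan_mono (b : V) : Monotone fun n => pathSpan K G n b := fun _ _ h =>
  Submodule.span_mono fun _ ⟨l, h0, hl, hx⟩ => ⟨l, h0, hl.trans h, hx⟩

theorem realSpan_mul_vert_eq {x : LeavittPathAlgebra K G} (hx : x ∈ realSpan K G) (b : V) :
    ∃ n, ∃ k : K, ∃ y ∈ pathSpan K G n b, x * vert K G b = k • vert K G b + y := by
  induction hx using Submodule.span_induction with
  | mem x h =>
    obtain ⟨l, c, rfl⟩ := h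
    by_cases hb : c = b
    · subst hb
      rw [path_mul_vert]
      by_cases hl : l = []
      · exact ⟨0, 1, 0, zero_mem _, by rw [hl, path, one_smul, add_zero]⟩
      · exact ⟨l.length, 0, _, Submodule.subset_span ⟨l, hl, le_rfl, rfl⟩, by
          rw [zero_smul, zero_add]⟩
    · exact ⟨0, 0, 0, zero_mem _, by rw [path_mul_vert_of_ne l hb, zero_smul, add_zero]⟩
  | zero => exact ⟨0, 0, 0, zero_mem _, by rw [zero_mul, zero_smul, add_zero]⟩
  | add x y _ _ hx hy =>
    obtain ⟨m, k, z, hz, hx⟩ := hx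
    obtain ⟨n, k', z', hz', hy⟩ := hy
    refine ⟨max m n, k + k', z + z', add_mem (pathSpan_mono b (le_max_left m n) hz)
      (pathSpan_mono b (le_max_right m n) hz'), ?_⟩
    rw [add_mul, hx, hy, add_smul]
    abel
  | smul k x _ hx =>
    obtain ⟨m, k', z, hz, hx⟩ := hx
    exact ⟨m, k * k', k • z, Submodule.smul_mem _ _ hz, by
      rw [smul_mul_assoc, hx, smul_add, mul_smul]⟩

theorem ghost_mul_pathSpan {n : ℕ} {b : V} {y : LeavittPathAlgebra K G}
    (hy : y ∈ pathSpan K G (n + 1) b) (e : E) :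
    ∃ k : K, ∃ z ∈ pathSpan K G n b, ghost K G e * y = k • vert K G b + z := by
  induction hy using Submodule.span_induction with
  | mem y h =>
    obtain ⟨l, hl, hn, rfl⟩ := h
    obtain ⟨f, l, rfl⟩ := List.exists_cons_of_ne_nil hl
    have h0 : ghost K G e * path K G (f :: l) b = path K G l b ∨
        ghost K G e * path K G (f :: l) b = 0 := by
      rw [path, ← mul_assoc]
      by_cases h : e = f
      · rw [h, ghost_mul_self]
        exact vert_mul_path_cases _ _ _
      · rw [ghost_mul_of_ne h, zero_mul]
        exact .inr rfl
    rcases h0 with h0 | h0 <;> rw [h0]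
    · by_cases hl : l = []
      · exact ⟨1, 0, zero_mem _, by rw [hl, path, one_smul, add_zero]⟩
      · exact ⟨0, _, Submodule.subset_span ⟨l, hl, by simpa using hn, rfl⟩, by
          rw [zero_smul, zero_add]⟩
    · exact ⟨0, 0, zero_mem _, by rw [zero_smul, add_zero]⟩
  | zero => exact ⟨0, 0, zero_mem _, by rw [mul_zero, zero_smul, add_zero]⟩
  | add x y _ _ hx hy =>
    obtain ⟨k, z, hz, hx⟩ := hx
    obtain ⟨k', z', hz', hy⟩ := hy
    refine ⟨k + k', z + z', add_mem hz hz', ?_⟩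
    rw [mul_add, hx, hy, add_smul]
    abel
  | smul k x _ hx =>
    obtain ⟨k', z, hz, hx⟩ := hx
    exact ⟨k * k', k • z, Submodule.smul_mem _ _ hz, by
      rw [mul_smul_comm, hx, smul_add, mul_smul]⟩

theorem vert_mul_pathSpan_of_sink {n : ℕ} {a b : V} (ha : ¬ ∃ e, G.s e = a)
    {y : LeavittPathAlgebra K G} (hy : y ∈ pathSpan K G n b) : vert K G a * y = 0 := by
  induction hy using Submodule.span_induction with
  | mem y h =>
    obtain ⟨l, hl, -, rfl⟩ := h
    obtain ⟨f, l, rfl⟩ := List.exists_cons_of_ne_nil hl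
    exact vert_mul_path_of_not fun h => ha ⟨f, h.1⟩
  | zero => exact mul_zero _
  | add x y _ _ hx hy => rw [mul_add, hx, hy, add_zero]
  | smul k x _ hx => rw [mul_smul_comm, hx, smul_zero]

variable (K G) in
/-- The span of the nonempty closed paths based at `b`. -/
noncomputable def closedSpan (b : V) : Submodule K (LeavittPathAlgebra K G) :=
  Submodule.span K ((path K G · b) '' G.closedPaths b)

theorem vert_mul_closedSpan {b : V} {y : LeavittPathAlgebra K G} (hy : y ∈ closedSpan K G b) :
    vert K G b * y = y := by
  induction hy using Submodule.span_induction with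
  | mem y h =>
    obtain ⟨l, hl, rfl⟩ := h
    exact vert_mul_path hl.2
  | zero => exact mul_zero _
  | add x y _ _ hx hy => rw [mul_add, hx, hy]
  | smul k x _ hx => rw [mul_smul_comm, hx]

theorem vert_mul_pathSpan_mem {n : ℕ} {b : V} {y : LeavittPathAlgebra K G}
    (hy : y ∈ pathSpan K G n b) : vert K G b * y ∈ closedSpan K G b := by
  induction hy using Submodule.span_induction with
  | mem y h =>
    obtain ⟨l, hl, -, rfl⟩ := h
    by_cases hp : G.IsPathFrom b l b
    · rw [vert_mul_path hp]
      exact Submodule.subset_span ⟨l, ⟨hl, hp⟩, rfl⟩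
    · rw [vert_mul_path_of_not hp]
      exact zero_mem _
  | zero => rw [mul_zero]; exact zero_mem _
  | add x y _ _ hx hy => rw [mul_add]; exact add_mem hx hy
  | smul k x _ hx => rw [mul_smul_comm]; exact Submodule.smul_mem _ _ hx

/-- Left multiplication by ghost edges shortens an element without constant term, and cannot lead
into `I` along all edges; so it reaches an element outside `I` with a nonzero constant term. -/
theorem exists_constant_ne_zero [Finite V] [Finite E] {n : ℕ} {b : V} {k : K}
    {y : LeavittPathAlgebra K G} (hy : y ∈ pathSpan K G n b) (hJ : k • vert K G b + y ∈ J)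
    (hI : k • vert K G b + y ∉ I) :
    ∃ k : K, k ≠ 0 ∧ ∃ y ∈ closedSpan K G b,
      k • vert K G b + y ∈ J ∧ k • vert K G b + y ∉ I := by
  induction n generalizing k y with
  | zero =>
    have hy0 : y = 0 := by
      rw [pathSpan, Submodule.span_eq_bot.2, Submodule.mem_bot] at hy
      · exact hy
      · rintro x ⟨l, hl, h0, -⟩
        exact absurd (List.eq_nil_of_length_eq_zero (Nat.le_zero.1 h0)) hl
    subst hy0
    refine ⟨k, ?_, 0, zero_mem _, hJ, hI⟩
    rintro rfl
    rw [zero_smul, add_zero] at hI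
    exact hI (zero_mem I)
  | succ n ih =>
    by_contra hno
    refine hI (mem_of_forall_vert_mul_mem I fun a => ?_)
    by_cases hab : k ≠ 0 ∧ a = b
    · obtain ⟨hk, rfl⟩ := hab
      by_contra hba
      have heq : vert K G a * (k • vert K G a + y) = k • vert K G a + vert K G a * y := by
        rw [mul_add, mul_smul_comm, vert_mul_self]
      exact hno ⟨k, hk, _, vert_mul_pathSpan_mem hy, heq ▸ J.mul_mem_left _ _ hJ, heq ▸ hba⟩
    · have hk : k • (vert K G a * vert K G b) = 0 := by
        by_cases hk : k = 0
        · rw [hk, zero_smul]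
        · rw [vert_mul_of_ne fun h => hab ⟨hk, h⟩, smul_zero]
      by_cases ha : ∃ e, G.s e = a
      · refine vert_mul_mem_of_forall_ghost_mul_mem I ha fun e he => ?_
        by_contra hge
        obtain ⟨k', z, hz, hyz⟩ := ghost_mul_pathSpan hy e
        have heq : ghost K G e * (k • vert K G b + y) = k' • vert K G b + z := by
          rw [mul_add, hyz, mul_smul_comm, ← ghost_mul_source, he, mul_assoc, ← mul_smul_comm, hk,
            mul_zero, zero_add]
        exact hno (ih hz (heq ▸ J.mul_mem_left _ _ hJ) (heq ▸ hge))
      · rw [mul_add, mul_smul_comm, hk, vert_mul_pathSpan_of_sink ha hy, add_zero]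
        exact zero_mem I

/-- Every element of `J` outside `I` yields one that is supported on the closed paths at a single
vertex and has a nonzero constant term. -/
theorem exists_closedSpan_mem_notMem [Finite V] [Finite E] {x : LeavittPathAlgebra K G}
    (hJ : x ∈ J) (hI : x ∉ I) :
    ∃ b, ∃ k : K, k ≠ 0 ∧ ∃ y ∈ closedSpan K G b,
      k • vert K G b + y ∈ J ∧ k • vert K G b + y ∉ I := by
  obtain ⟨x, hx, hJ, hI⟩ := exists_realSpan_mem_notMem hJ hI
  have : ∃ b, x * vert K G b ∉ I := by
    by_contra! h
    exact hI (mem_of_forall_mul_vert_mem I h)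
  obtain ⟨b, hb⟩ := this
  obtain ⟨n, k, y, hy, heq⟩ := realSpan_mul_vert_eq hx b
  exact ⟨b, exists_constant_ne_zero hy (heq ▸ J.mul_mem_right _ _ hJ) (heq ▸ hb)⟩

end Reduction

/-! ### Polynomials in a shortest closed path -/

variable (K G) in
/-- The shortest closed path at `b`, as an element of `L_K(E)`; it is `b` itself if `b` lies on no
closed path. -/
noncomputable def loop (b : V) : LeavittPathAlgebra K G := path K G (G.shortestLoop b) b

variable (K G) in
/-- Evaluation of polynomials at `loop K G b` in the corner of `b`, whose unit is `b`. -/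
noncomputable def evalLoop (b : V) : K[X] →ₗ[K] LeavittPathAlgebra K G :=
  (LinearMap.applyₗ (vert K G b)).comp (aeval (LinearMap.mulLeft K (loop K G b))).toLinearMap

theorem evalLoop_one (b : V) : evalLoop K G b 1 = vert K G b := by
  simp [evalLoop]

theorem evalLoop_X_mul (b : V) (p : K[X]) :
    evalLoop K G b (X * p) = loop K G b * evalLoop K G b p := by
  simp [evalLoop]

section LoopIdeal

variable [Finite V]

theorem evalLoop_mul_mem {I : TwoSidedIdeal (LeavittPathAlgebra K G)} {b : V} (p : K[X]) {q : K[X]}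
    (hq : evalLoop K G b q ∈ I) : evalLoop K G b (p * q) ∈ I := by
  induction p using Polynomial.induction_on' with
  | add p p' hp hp' => rw [add_mul, map_add]; exact I.add_mem hp hp'
  | monomial n k =>
    rw [← C_mul_X_pow_eq_monomial, mul_assoc, ← smul_eq_C_mul, map_smul]
    refine smul_mem I k ?_
    induction n with
    | zero => rwa [pow_zero, one_mul]
    | succ n ih =>
      rw [pow_succ', mul_assoc, evalLoop_X_mul]
      exact I.mul_mem_left _ _ ih

/-- The polynomials whose value at the shortest closed path based at `b` lies in `I`. -/
noncomputable def loopIdeal (I : TwoSidedIdeal (LeavittPathAlgebra K G)) (b : V) : Ideal K[X] where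
  carrier := {p | evalLoop K G b p ∈ I}
  zero_mem' := by simp [zero_mem]
  add_mem' := fun hp hq => by
    rw [Set.mem_ofPred_eq, map_add]
    exact I.add_mem hp hq
  smul_mem' := fun p _ hq => evalLoop_mul_mem p hq

theorem mem_loopIdeal {I : TwoSidedIdeal (LeavittPathAlgebra K G)} {b : V} {p : K[X]} :
    p ∈ loopIdeal I b ↔ evalLoop K G b p ∈ I := Iff.rfl

theorem loopIdeal_mono {I J : TwoSidedIdeal (LeavittPathAlgebra K G)} (h : I ≤ J) (b : V) :
    loopIdeal I b ≤ loopIdeal J b := fun _ hp => h hp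

end LoopIdeal

/-! ### Closed paths that are not powers of the shortest one -/

/-- Either all closed paths at `b` are powers of the shortest one, or one of them branches off from
it. -/
theorem range_evalLoop_or_exists_not_prefix (b : V) :
    (∀ l ∈ G.closedPaths b, path K G l b ∈ LinearMap.range (evalLoop K G b)) ∨
      ∃ d ∈ G.closedPaths b, ¬ G.shortestLoop b <+: d ∧ ¬ d <+: G.shortestLoop b := by
  refine or_iff_not_imp_right.2 fun hno l hl => ?_
  push Not at hno
  induction hn : l.length using Nat.strong_induction_on generalizing l with
  | _ n ih =>
    subst hn
    have hc := DirectedGraph.shortestLoop_mem ⟨l, hl⟩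
    have hpre : G.shortestLoop b <+: l := by
      by_contra h
      exact h (DirectedGraph.shortestLoop_prefix_of_prefix hl (hno l hl h))
    obtain ⟨m, rfl⟩ := hpre
    have hm : G.IsPathFrom b m b := hc.2.of_append hl.2
    have hmr : path K G m b ∈ LinearMap.range (evalLoop K G b) := by
      by_cases h0 : m = []
      · exact ⟨1, by rw [h0, evalLoop_one, path]⟩
      · refine ih m.length ?_ m ⟨h0, hm⟩ rfl
        rw [List.length_append]
        exact Nat.lt_add_of_pos_left (List.length_pos_of_ne_nil hc.1)
    obtain ⟨p, hp⟩ := hmr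
    exact ⟨X * p, by rw [evalLoop_X_mul, hp, loop, path_append _ hm]⟩

variable (K G) in
/-- The map `x ↦ l* x l` for a list of edges `l` ending at `b`. -/
noncomputable def compress (l : List E) (b : V) : Module.End K (LeavittPathAlgebra K G) :=
  LinearMap.mulLeft K (ghostPath K G l b) ∘ₗ LinearMap.mulRight K (path K G l b)

theorem compress_apply (l : List E) (b : V) (x : LeavittPathAlgebra K G) :
    compress K G l b x = ghostPath K G l b * (x * path K G l b) := rfl

theorem compress_mem {I : TwoSidedIdeal (LeavittPathAlgebra K G)} (l : List E) (b : V)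
    {x : LeavittPathAlgebra K G} (hx : x ∈ I) : compress K G l b x ∈ I :=
  I.mul_mem_left _ _ (I.mul_mem_right _ _ hx)

theorem compress_pow_mem {I : TwoSidedIdeal (LeavittPathAlgebra K G)} (l : List E) (b : V) (n : ℕ)
    {x : LeavittPathAlgebra K G} (hx : x ∈ I) : (compress K G l b ^ n) x ∈ I := by
  induction n with
  | zero => exact hx
  | succ n ih => rw [pow_succ', Module.End.mul_apply]; exact compress_mem l b ih

theorem compress_vert {l : List E} {b : V} (h : G.IsPathFrom b l b) :
    compress K G l b (vert K G b) = vert K G b := by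
  rw [compress_apply, vert_mul_path h, ghostPath_mul_path h]

theorem compress_pow_vert {l : List E} {b : V} (h : G.IsPathFrom b l b) (n : ℕ) :
    (compress K G l b ^ n) (vert K G b) = vert K G b := by
  induction n with
  | zero => rfl
  | succ n ih => rw [pow_succ, Module.End.mul_apply, compress_vert h, ih]

theorem compress_pow_mul_path (l : List E) (b : V) (n : ℕ) (x : LeavittPathAlgebra K G) :
    (compress K G l b ^ n) (x * path K G l b) = (compress K G l b ^ n) x * path K G l b := by
  induction n generalizing x with
  | zero => rfl
  | succ n ih =>
    rw [pow_succ, Module.End.mul_apply, Module.End.mul_apply, ← ih]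
    simp only [compress_apply, mul_assoc]

/-- If `c` is the shortest closed path at `b` and `y` is a combination of nonempty closed paths,
then `(c*)ⁿ y cⁿ` starts with `c` once `n` is large: `c*` kills each closed path that is not a power
of `c` as soon as all its initial factors `c` are cancelled. -/
theorem exists_compress_pow_eq_loop_mul {b : V} {y : LeavittPathAlgebra K G}
    (hy : y ∈ closedSpan K G b) :
    ∃ N, ∀ n ≥ N, ∃ z, (compress K G (G.shortestLoop b) b ^ n) y = loop K G b * z := by
  induction hy using Submodule.span_induction with
  | mem y h =>
    obtain ⟨l, hl, rfl⟩ := h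
    induction hn : l.length using Nat.strong_induction_on generalizing l with
    | _ k ih =>
      subst hn
      have hc := DirectedGraph.shortestLoop_mem ⟨l, hl⟩
      by_cases hpre : G.shortestLoop b <+: l
      · obtain ⟨m, rfl⟩ := hpre
        have hm : G.IsPathFrom b m b := hc.2.of_append hl.2
        have hstep : compress K G (G.shortestLoop b) b (path K G (G.shortestLoop b ++ m) b) =
            path K G m b * loop K G b := by
          rw [compress_apply, path_append _ hm, mul_assoc, ← mul_assoc, ghostPath_mul_path hc.2,
            ← mul_assoc, vert_mul_path hm, loop]
        have hmN : ∃ N, ∀ n ≥ N, ∃ z, (compress K G (G.shortestLoop b) b ^ n)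
            (path K G m b * loop K G b) = loop K G b * z := by
          by_cases h0 : m = []
          · refine ⟨0, fun n _ => ⟨vert K G b, ?_⟩⟩
            rw [h0, loop, compress_pow_mul_path, path, compress_pow_vert hc.2, vert_mul_path hc.2,
              path_mul_vert]
          · have hlt : m.length < (G.shortestLoop b ++ m).length := by
              rw [List.length_append]
              exact Nat.lt_add_of_pos_left (List.length_pos_of_ne_nil hc.1)
            obtain ⟨N, hN⟩ := ih m.length hlt m ⟨h0, hm⟩ rfl
            refine ⟨N, fun n hn => ?_⟩
            obtain ⟨z, hz⟩ := hN n hn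
            exact ⟨z * loop K G b, by rw [loop, compress_pow_mul_path, hz, loop, mul_assoc]⟩
        obtain ⟨N, hN⟩ := hmN
        refine ⟨N + 1, fun n hn => ?_⟩
        obtain ⟨n, rfl⟩ := Nat.exists_eq_add_of_le' (Nat.one_le_of_lt hn)
        obtain ⟨z, hz⟩ := hN n (Nat.le_of_succ_le_succ hn)
        exact ⟨z, by rw [pow_succ, Module.End.mul_apply, hstep, hz]⟩
      · refine ⟨1, fun n hn => ⟨0, ?_⟩⟩
        obtain ⟨n, rfl⟩ := Nat.exists_eq_add_of_le' hn
        rw [pow_succ, Module.End.mul_apply, compress_apply, ← mul_assoc,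
          ghostPath_mul_path_of_not_prefix b b hpre
            (mt (DirectedGraph.shortestLoop_prefix_of_prefix hl) hpre), zero_mul, map_zero,
          mul_zero]
  | zero => exact ⟨0, fun n _ => ⟨0, by rw [map_zero, mul_zero]⟩⟩
  | add x y _ _ hx hy =>
    obtain ⟨M, hM⟩ := hx
    obtain ⟨N, hN⟩ := hy
    refine ⟨max M N, fun n hn => ?_⟩
    obtain ⟨z, hz⟩ := hM n (le_of_max_le_left hn)
    obtain ⟨z', hz'⟩ := hN n (le_of_max_le_right hn)
    exact ⟨z + z', by rw [map_add, hz, hz', mul_add]⟩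
  | smul k x _ hx =>
    obtain ⟨N, hN⟩ := hx
    refine ⟨N, fun n hn => ?_⟩
    obtain ⟨z, hz⟩ := hN n hn
    exact ⟨k • z, by rw [map_smul, hz, mul_smul_comm]⟩

variable [Finite V]

/-- An element with nonzero constant term, supported on closed paths at `b`, is a polynomial in the
shortest closed path, or every ideal that contains it contains `b`. -/
theorem vert_mem_or_mem_range_evalLoop {I : TwoSidedIdeal (LeavittPathAlgebra K G)} {b : V} {k : K}
    (hk : k ≠ 0) {y : LeavittPathAlgebra K G} (hy : y ∈ closedSpan K G b)
    (hI : k • vert K G b + y ∈ I) :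
    vert K G b ∈ I ∨ k • vert K G b + y ∈ LinearMap.range (evalLoop K G b) := by
  rcases range_evalLoop_or_exists_not_prefix (K := K) (G := G) b with h | ⟨d, hd, hcd, hdc⟩
  · refine .inr (add_mem (Submodule.smul_mem _ _ ⟨1, evalLoop_one b⟩) ?_)
    exact (Submodule.span_le.2 (Set.image_subset_iff.2 h)) hy
  · left
    have hc := DirectedGraph.shortestLoop_mem ⟨d, hd⟩
    obtain ⟨N, hN⟩ := exists_compress_pow_eq_loop_mul hy
    obtain ⟨z, hz⟩ := hN N le_rfl
    have hmem := compress_mem d b (compress_pow_mem (G.shortestLoop b) b N hI)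
    -- `d* c z d = 0` since `d* c = 0`, so only the constant term survives.
    rw [map_add, map_smul, compress_pow_vert hc.2, hz, map_add, map_smul, compress_vert hd.2,
      compress_apply d b (loop K G b * z), ← mul_assoc, ← mul_assoc, loop,
      ghostPath_mul_path_of_not_prefix b b hdc hcd, zero_mul, zero_mul, add_zero] at hmem
    have := smul_mem I k⁻¹ hmem
    rwa [smul_smul, inv_mul_cancel₀ hk, one_smul] at this

/-- Nested ideals with the same loop ideals are equal. -/
theorem eq_of_loopIdeal_eq [Finite E] {I J : TwoSidedIdeal (LeavittPathAlgebra K G)} (hIJ : I ≤ J)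
    (h : ∀ b, loopIdeal J b = loopIdeal I b) : J = I := by
  refine le_antisymm (fun x hJ => ?_) hIJ
  by_contra hI
  obtain ⟨b, k, hk, y, hy, hyJ, hyI⟩ := exists_closedSpan_mem_notMem hJ hI
  have hle {p : K[X]} (hp : evalLoop K G b p ∈ J) : evalLoop K G b p ∈ I :=
    mem_loopIdeal.1 (h b ▸ mem_loopIdeal.2 hp)
  rcases vert_mem_or_mem_range_evalLoop hk hy hyJ with hb | ⟨p, hp⟩
  · have hbI : vert K G b ∈ I := evalLoop_one (K := K) (G := G) b ▸
      hle ((evalLoop_one (K := K) (G := G) b).symm ▸ hb)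
    have := I.mul_mem_right _ (k • vert K G b + y) hbI
    rw [mul_add, mul_smul_comm, vert_mul_self, vert_mul_closedSpan hy] at this
    exact hyI this
  · exact hyI (hp ▸ hle (hp ▸ hyJ))

end LeavittPathAlgebra

theorem mainTheorem3 {K : Type*} [Field K] {V : Type*} {E : Type*} [Finite V] [Finite E]
    (G : DirectedGraph V E) : IsTwoSidedNoetherian (LeavittPathAlgebra K G) := by
  intro I hI
  have stab (b : V) : ∃ n, ∀ m, n ≤ m →
      LeavittPathAlgebra.loopIdeal (I n) b = LeavittPathAlgebra.loopIdeal (I m) b :=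
    WellFoundedGT.monotone_chain_condition ⟨fun n => LeavittPathAlgebra.loopIdeal (I n) b,
      fun _ _ h => LeavittPathAlgebra.loopIdeal_mono (hI h) b⟩
  choose N hN using stab
  obtain ⟨n, hn⟩ := Finite.exists_le N
  exact ⟨n, fun m hm => LeavittPathAlgebra.eq_of_loopIdeal_eq (hI hm) fun b =>
    (hN b m ((hn b).trans hm)).symm.trans (hN b n (hn b))⟩
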